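/- Let $K$ be a field of characteristic $0$ and let $\mathrm{GA}_3(K)$ be the group of automorphisms of the $K$-algebra $K[x,y,z]$. Write $(x_1,x_2,x_3)=(x,y,z)$. Let $A$ be the subgroup of affine automorphisms (those $\sigma$ for which $\sigma(x),\sigma(y),\sigma(z)$ all have degree $1$), let $B$ be the subgroup of triangular automorphisms (those $\sigma$ with $\sigma(x_i)\in K^*x_i+K[x_{i+1},\dots,x_3]$ for $i=1,2,3$), and let $T=\langle A,B\rangle$ be the subgroup of tame automorphisms. Let $\mathcal R^2(K[z])$ be the set of polynomials $F\in K[z][x,y]=K[x,y,z]$ that can be written as $$F=p_2\,y+Q_2\bigl(p_1x+Q_1(y)\bigr)\quad\text{with } p_1,p_2\in K(z)\setminus\{0\}\text{ and } Q_1,Q_2\in K(z)[y].$$ Let $\sigma\in \mathrm{GA}_3(K)\setminus A$ be a non-affine automorphism such that $\sigma(z)=z$ and $\sigma(y)\in\mathcal R^2(K[z])$. Then $\sigma$ is co-tame, that is, $T\subseteq\langle A,\sigma\rangle$: the subgroup of $\mathrm{GA}_3(K)$ generated by $\sigma$ and the affine automorphisms contains every tame automorphism. -/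

import Mathlib

noncomputable section

namespace CoTame

open MvPolynomial

/-- `GA_n(R)`: the group of automorphisms of the `R`-algebra `R[x_1, …, x_n]`. -/
abbrev GA (n : ℕ) (R : Type*) [CommRing R] : Type _ :=
  MvPolynomial (Fin n) R ≃ₐ[R] MvPolynomial (Fin n) R

/-- `Aff_n(R)`: all the components `σ(x_i)` have degree one. -/
def Aff (n : ℕ) (R : Type*) [CommRing R] : Set (GA n R) :=
  {σ | ∀ i, (σ (X i)).totalDegree = 1}

/-- `BA_n(R)`: triangular automorphisms, `σ(x_i) ∈ R^* x_i + R[x_{i+1}, …, x_n]`. -/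
def BA (n : ℕ) (R : Type*) [CommRing R] : Set (GA n R) :=
  {σ | ∀ i, ∃ u : Rˣ, ∃ f ∈ supported R {j : Fin n | i < j}, σ (X i) = C (u : R) * X i + f}

/-- `TA_n(R)`: the group of tame automorphisms. -/
def TA (n : ℕ) (R : Type*) [CommRing R] : Subgroup (GA n R) :=
  Subgroup.closure (Aff n R ∪ BA n R)

/-- `σ` is co-tame: every tame automorphism lies in the subgroup generated by
`σ` and the affine automorphisms. -/
def IsCoTame {n : ℕ} {R : Type*} [CommRing R] (σ : GA n R) : Prop :=
  TA n R ≤ Subgroup.closure (Aff n R ∪ {σ})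

/-- The polynomials `F_l ∈ R[x,y]` with `F_0 = y`, `F_1 = p_1 x + Q_1(y)` and
`F_l = p_l F_{l-2} + Q_l(F_{l-1})` for `l ≥ 2`. Here `x = X 0` and `y = X 1`. -/
def bersonPoly {R : Type*} [CommRing R] (p : ℕ → R) (Q : ℕ → Polynomial R) :
    ℕ → MvPolynomial (Fin 2) R
  | 0 => X 1
  | 1 => C (p 1) * X 0 + Polynomial.aeval (X 1 : MvPolynomial (Fin 2) R) (Q 1)
  | l + 2 => C (p (l + 2)) * bersonPoly p Q l +
      Polynomial.aeval (bersonPoly p Q (l + 1)) (Q (l + 2))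

/-- The class `B^l(R) ⊆ R[x,y]`; the coefficients `p_i` are non-zero-divisors. -/
def bersonClass (R : Type*) [CommRing R] : ℕ → Set (MvPolynomial (Fin 2) R)
  | 0 => {F | ∃ p ∈ nonZeroDivisors R, ∃ q : R, F = C p * X 1 + C q}
  | l + 1 => {F | ∃ (p : ℕ → R) (Q : ℕ → Polynomial R),
      (∀ i, p i ∈ nonZeroDivisors R) ∧ F = bersonPoly p Q (l + 1)}

/-- The rational class `R^l(R) = B^l(qt(R)) ∩ R[x,y]`, where `qt(R)` is the total
quotient ring of `R`. -/
def rationalClass (R : Type*) [CommRing R] (l : ℕ) : Set (MvPolynomial (Fin 2) R) :=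
  {F | MvPolynomial.map (algebraMap R (FractionRing R)) F ∈ bersonClass (FractionRing R) l}

/-- The canonical identification of `K[x,y,z]` with `K[z][x,y]`, where
`x = X 0`, `y = X 1`, `z = X 2` on the left. -/
def overZ (K : Type*) [CommRing K] :
    MvPolynomial (Fin 3) K →ₐ[K] MvPolynomial (Fin 2) (Polynomial K) :=
  aeval ![X 0, X 1, C Polynomial.X]

end CoTame

end

/-!
Write `H = ⟨A, σ⟩`. If `H` contains a triangular automorphism that is not affine, then it contains
a shear `x_i ↦ x_i + f` with `f` not affine. The admissible `f` form a vector space stable under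
the torus, hence spanned by monomials, and stable under expanding `(x_j + t c)^N` in powers of `t`
when `x_j ↦ x_j + t c` is in `H`. In at least three variables this yields every monomial, so `H`
contains all triangular automorphisms.

Otherwise every triangular element of `H` is affine. Work over `K(z)` and put `P = p₁ x + Q₁(y)`,
so that `σ(y) = p₂ y + Q₂(P)`. Conjugating `x ↦ x + l` (`l = 1, z`) by `σ` gives an element of `H`
fixing `σ(y)` and translating `P` by a multiple of `l`. If `deg Q₂ ≥ 2`, repeated commutators with
`x ↦ x + 1` turn it into one that fixes `P` and translates `y` by a nonzero multiple of `l`; this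
is a triangular element with `x ↦ x + (Q₁(y) - Q₁(y + l s)) / p₁`. Since it is affine over `K` for
both `l = 1` and `l = z`, the polynomial `Q₁ / p₁` is `w y` up to a constant, with `w ∈ K`. An
affine change of coordinates then reduces `σ(y)` to length one, where the same argument applies
to the single polynomial left, and then to length zero, where `σ` is triangular and hence affine.
-/

noncomputable section

namespace CoTame

open MvPolynomial

section Interpolation

theorem mem_of_forall_sum_prod_pow_smul_mem {K ι κ M : Type*} [Field K] [Infinite K]
    [AddCommGroup M] [Module K M] (V : Submodule K M) (s : Finset κ) (w : κ → ι →₀ ℕ)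
    (hw : Set.InjOn w s) (v : κ → M)
    (h : ∀ t : ι → K, (∀ i, t i ≠ 0) → ∑ k ∈ s, ((w k).prod fun i e => t i ^ e) • v k ∈ V) :
    ∀ k ∈ s, v k ∈ V := by
  classical
  intro k hk
  rw [← Submodule.Quotient.mk_eq_zero, ← Module.forall_dual_apply_eq_zero_iff K]
  intro ℓ
  let P : MvPolynomial ι K := ∑ l ∈ s, monomial (w l) (ℓ (V.mkQ (v l)))
  have hP : P = 0 := by
    refine funext_set (fun _ => {0}ᶜ) (fun _ => (Set.finite_singleton 0).infinite_compl)
      fun t ht => ?_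
    have hℓ : ℓ (V.mkQ (∑ l ∈ s, ((w l).prod fun i e => t i ^ e) • v l)) = 0 := by
      rw [Submodule.mkQ_apply, (Submodule.Quotient.mk_eq_zero V).2 (h t fun i => ht i trivial),
        map_zero]
    simpa only [P, map_sum, eval_monomial, map_zero, map_smul, smul_eq_mul, mul_comm] using hℓ
  calc ℓ (V.mkQ (v k)) = coeff (w k) P := by
        simp only [P, coeff_sum, coeff_monomial]
        rw [Finset.sum_eq_single_of_mem k hk fun l hl hlk => if_neg fun e => hlk (hw hl hk e),
          if_pos rfl]
    _ = 0 := by rw [hP, coeff_zero]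

end Interpolation

section Automorphisms

variable {R : Type*} [CommRing R] {σ τ : Type*} {n : ℕ}

lemma algHom_eqOn_supported {A : Type*} [CommRing A] [Algebra R A] {s : Set σ}
    {φ ψ : MvPolynomial σ R →ₐ[R] A} (h : ∀ j ∈ s, φ (X j) = ψ (X j)) :
    Set.EqOn φ ψ (supported R s) := by
  have hle : supported R s ≤ AlgHom.equalizer φ ψ :=
    Algebra.adjoin_le (Set.forall_mem_image.2 h)
  exact fun f hf => hle hf

lemma algHom_mapsTo_supported {s : Set σ} {t : Set τ}
    {φ : MvPolynomial σ R →ₐ[R] MvPolynomial τ R} (h : ∀ j ∈ s, φ (X j) ∈ supported R t) :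
    Set.MapsTo φ (supported R s) (supported R t) := by
  have hle : supported R s ≤ (supported R t).comap φ :=
    Algebra.adjoin_le (Set.forall_mem_image.2 h)
  exact fun f hf => hle hf

lemma C_mem_supported (s : Set σ) (r : R) : C r ∈ supported R s :=
  (supported R s).algebraMap_mem r

lemma monomial_one_mem_supported_compl {i : σ} {m : σ →₀ ℕ} (hm : m i = 0) :
    (monomial m 1 : MvPolynomial σ R) ∈ supported R {i}ᶜ := by
  rw [monomial_eq, C_1, one_mul]
  refine prod_mem fun k hk => pow_mem (Algebra.subset_adjoin (Set.mem_image_of_mem _ ?_)) _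
  rintro rfl
  exact Finsupp.mem_support_iff.1 hk hm

lemma monomial_single_add_one (k : σ) (e : ℕ) (m : σ →₀ ℕ) :
    (monomial (Finsupp.single k e + m) 1 : MvPolynomial σ R) = X k ^ e * monomial m 1 := by
  rw [X_pow_eq_monomial, monomial_mul, one_mul]

lemma apply_eq_zero_of_mem_support {i : σ} {f : MvPolynomial σ R}
    (hf : f ∈ supported R {i}ᶜ) {m : σ →₀ ℕ} (hm : m ∈ f.support) : m i = 0 := by
  by_contra hmi
  exact mem_supported.1 hf ((mem_vars_iff_mem_support i).2 ⟨m, hm, Finsupp.mem_support_iff.2 hmi⟩)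
    rfl

lemma supported_Ioi_le_compl (i : Fin n) : supported R {j | i < j} ≤ supported R {i}ᶜ :=
  supported_mono fun _ hj => ne_of_gt hj

namespace GA

lemma ext_X {g h : GA n R} (H : ∀ i, g (X i) = h (X i)) : g = h :=
  AlgEquiv.coe_toAlgHom_injective (algHom_ext H)

lemma apply_C (g : GA n R) (r : R) : g (C r) = C r :=
  g.commutes r

lemma eqOn_supported {s : Set (Fin n)} {g h : GA n R} (H : ∀ j ∈ s, g (X j) = h (X j)) :
    Set.EqOn g h (supported R s) :=
  algHom_eqOn_supported (φ := g.toAlgHom) (ψ := h.toAlgHom) H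

lemma mapsTo_supported {s t : Set (Fin n)} {g : GA n R} (H : ∀ j ∈ s, g (X j) ∈ supported R t) :
    Set.MapsTo g (supported R s) (supported R t) :=
  algHom_mapsTo_supported (φ := g.toAlgHom) H

lemma apply_eq_self_of_mem_supported {s : Set (Fin n)} {g : GA n R} (H : ∀ j ∈ s, g (X j) = X j)
    {f : MvPolynomial (Fin n) R} (hf : f ∈ supported R s) : g f = f :=
  eqOn_supported (h := 1) H hf

end GA

/-- The elementary automorphism `x_i ↦ u x_i + f` fixing the other variables, where `f` does not
involve `x_i`. -/
def elementary (i : Fin n) (u : Rˣ) (f : MvPolynomial (Fin n) R) (hf : f ∈ supported R {i}ᶜ) :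
    GA n R :=
  have fix (p : MvPolynomial (Fin n) R) : aeval (Function.update X i p) f = f :=
    algHom_eqOn_supported (ψ := AlgHom.id R _)
      (fun j hj => by rw [aeval_X, Function.update_of_ne hj, AlgHom.id_apply]) hf
  AlgEquiv.ofAlgHom (aeval (Function.update X i (C (u : R) * X i + f)))
    (aeval (Function.update X i (C ((u⁻¹ : Rˣ) : R) * (X i - f))))
    (algHom_ext fun j => by
      rcases eq_or_ne j i with rfl | hj
      · simp [fix, ← mul_assoc, ← C_mul, -aeval_eq_bind₁]
      · simp [hj])
    (algHom_ext fun j => by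
      rcases eq_or_ne j i with rfl | hj
      · simp [fix, ← mul_assoc, ← C_mul, -aeval_eq_bind₁]
      · simp [hj])

section Elementary

variable {i : Fin n} {u : Rˣ} {f : MvPolynomial (Fin n) R} {hf : f ∈ supported R {i}ᶜ}

@[simp]
lemma elementary_X_self : elementary i u f hf (X i) = C (u : R) * X i + f := by
  simp [elementary]

lemma elementary_X_of_ne {j : Fin n} (hj : j ≠ i) : elementary i u f hf (X j) = X j := by
  simp [elementary, hj]

lemma elementary_apply_of_mem_supported {p : MvPolynomial (Fin n) R}
    (hp : p ∈ supported R {i}ᶜ) : elementary i u f hf p = p :=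
  GA.apply_eq_self_of_mem_supported (fun _ hj => elementary_X_of_ne hj) hp

lemma elementary_mul {v : Rˣ} {g : MvPolynomial (Fin n) R} {hg : g ∈ supported R {i}ᶜ} :
    elementary i u f hf * elementary i v g hg =
      elementary i (v * u) (C (v : R) * f + g)
        (add_mem (mul_mem (C_mem_supported _ _) hf) hg) := by
  refine GA.ext_X fun j => ?_
  rcases eq_or_ne j i with rfl | hj
  · simp only [AlgEquiv.mul_apply, elementary_X_self, map_add, map_mul, GA.apply_C,
      elementary_apply_of_mem_supported hg, Units.val_mul]
    ring
  · simp only [AlgEquiv.mul_apply, elementary_X_of_ne hj]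

end Elementary

/-- The diagonal automorphism `x_i ↦ t_i x_i`. -/
def diagonal (t : Fin n → Rˣ) : GA n R :=
  AlgEquiv.ofAlgHom (aeval fun i => C (t i : R) * X i)
    (aeval fun i => C (((t i)⁻¹ : Rˣ) : R) * X i)
    (algHom_ext fun j => by simp [← mul_assoc, ← C_mul])
    (algHom_ext fun j => by simp [← mul_assoc, ← C_mul])

lemma diagonal_X (t : Fin n → Rˣ) (i : Fin n) : diagonal t (X i) = C (t i : R) * X i := by
  simp [diagonal]

lemma diagonal_monomial (t : Fin n → Rˣ) (m : Fin n →₀ ℕ) (a : R) :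
    diagonal t (monomial m a) = (m.prod fun i e => (t i : R) ^ e) • monomial m a := by
  simp only [monomial_eq, Finsupp.prod, map_mul, GA.apply_C, map_prod, map_pow, diagonal_X,
    mul_pow, Finset.prod_mul_distrib, smul_eq_C_mul]
  ring

lemma finSuccEquiv_rename_succ (f : MvPolynomial (Fin n) R) :
    finSuccEquiv R n (rename Fin.succ f) = Polynomial.C f := by
  have h : (finSuccEquiv R n).toAlgHom.comp (rename Fin.succ) =
      (Algebra.ofId (MvPolynomial (Fin n) R) (Polynomial (MvPolynomial (Fin n) R))).restrictScalars
        R :=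
    algHom_ext fun j => by simp [finSuccEquiv_X_succ, Algebra.ofId_apply]
  exact DFunLike.congr_fun h f

lemma finSuccEquiv_apply_eq_comp {g : GA (n + 1) R} (h : ∀ j : Fin n, g (X j.succ) = X j.succ)
    (p : MvPolynomial (Fin (n + 1)) R) :
    finSuccEquiv R n (g p) = (finSuccEquiv R n p).comp (finSuccEquiv R n (g (X 0))) := by
  have heq : (finSuccEquiv R n).toAlgHom.comp g.toAlgHom =
      ((Polynomial.aeval (finSuccEquiv R n (g (X 0)))).restrictScalars R).comp
        (finSuccEquiv R n).toAlgHom :=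
    algHom_ext fun j => by
      refine Fin.cases ?_ (fun j => ?_) j
      · simp [finSuccEquiv_X_zero]
      · simp [finSuccEquiv_X_succ, h]
  exact DFunLike.congr_fun heq p

lemma exists_unit_of_comp_eq_X [IsDomain R] {p q : Polynomial R} (h : p.comp q = Polynomial.X) :
    ∃ u : Rˣ, ∃ r : R, q = Polynomial.C (u : R) * Polynomial.X + Polynomial.C r := by
  have hdeg : p.natDegree * q.natDegree = 1 := by
    rw [← Polynomial.natDegree_comp, h, Polynomial.natDegree_X]
  have hq : q.natDegree = 1 := Nat.eq_one_of_mul_eq_one_left hdeg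
  have hunit : p.leadingCoeff * q.leadingCoeff = 1 := by
    rw [← Polynomial.leadingCoeff_X (R := R), ← h, Polynomial.leadingCoeff_comp (by omega),
      Nat.eq_one_of_mul_eq_one_right hdeg, pow_one]
  obtain ⟨u, hu⟩ := IsUnit.of_mul_eq_one_right _ hunit
  refine ⟨u, q.coeff 0, ?_⟩
  rw [hu, Polynomial.leadingCoeff, hq]
  exact Polynomial.eq_X_add_C_of_natDegree_le_one hq.le

lemma exists_unit_of_apply_X_succ_eq_self [IsDomain R] {g : GA (n + 1) R}
    (h : ∀ j : Fin n, g (X j.succ) = X j.succ) :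
    ∃ u : Rˣ, ∃ f ∈ supported R {j | 0 < j}, g (X 0) = C (u : R) * X 0 + f := by
  have hinv : (finSuccEquiv R n (g⁻¹ (X 0))).comp (finSuccEquiv R n (g (X 0))) = Polynomial.X := by
    rw [← finSuccEquiv_apply_eq_comp h, ← AlgEquiv.mul_apply, mul_inv_cancel, AlgEquiv.one_apply,
      finSuccEquiv_X_zero]
  obtain ⟨u, f, hf⟩ := exists_unit_of_comp_eq_X hinv
  obtain ⟨r, hr, hur⟩ := isUnit_iff_eq_C_of_isReduced.1 u.isUnit
  refine ⟨hr.unit, rename Fin.succ f, ?_, (finSuccEquiv R n).injective ?_⟩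
  · exact algHom_mapsTo_supported (φ := rename Fin.succ) (s := Set.univ)
      (fun j _ => by simp)
      (by rw [supported_univ]; trivial)
  · rw [hf, hur, map_add, map_mul, finSuccEquiv_rename_succ, finSuccEquiv_X_zero,
      finSuccEquiv_apply]
    simp

lemma exists_apply_X_zero_eq_of_apply_X_succ_eq [IsDomain R] {φ θ : GA (n + 1) R}
    (h : ∀ j : Fin n, φ (X j.succ) = θ (X j.succ)) :
    ∃ u : Rˣ, ∃ f ∈ supported R {j | 0 < j}, φ (X 0) = C (u : R) * θ (X 0) + θ f := by
  obtain ⟨u, f, hf, hφ⟩ := exists_unit_of_apply_X_succ_eq_self (g := θ⁻¹ * φ) fun j => by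
    rw [AlgEquiv.mul_apply, h, ← AlgEquiv.mul_apply, inv_mul_cancel, AlgEquiv.one_apply]
  refine ⟨u, f, hf, ?_⟩
  rw [← GA.apply_C θ, ← map_mul, ← map_add, ← hφ, ← AlgEquiv.mul_apply, mul_inv_cancel_left]

end Automorphisms

section Affine

variable {R : Type*} [CommRing R] {n : ℕ}

lemma mem_of_totalDegree_le_one {σ : Type*} {V : Submodule R (MvPolynomial σ R)}
    {s : Set σ} (h1 : 1 ∈ V) (hX : ∀ i ∈ s, X i ∈ V) {f : MvPolynomial σ R}
    (hf : f ∈ supported R s) (hdeg : f.totalDegree ≤ 1) : f ∈ V := by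
  rw [f.as_sum]
  refine sum_mem fun m hm => ?_
  rw [monomial_eq, ← smul_eq_C_mul]
  refine V.smul_mem _ ?_
  have hle : m.degree ≤ 1 := (le_totalDegree hm).trans hdeg
  rcases Nat.le_one_iff_eq_zero_or_eq_one.1 hle with hm0 | hm1
  · rw [(Finsupp.degree_eq_zero_iff m).1 hm0, Finsupp.prod_zero_index]
    exact h1
  · have hsingle : ∃ i, Finsupp.single i 1 = m := Finsupp.range_single_one.ge hm1
    obtain ⟨i, rfl⟩ := hsingle
    simpa using hX i (mem_supported.1 hf ((mem_vars_iff_mem_support i).2 ⟨_, hm, by simp⟩))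

variable [Nontrivial R]

namespace GA

lemma mem_Aff_of_totalDegree_le_one {g : GA n R} (h : ∀ i, (g (X i)).totalDegree ≤ 1) :
    g ∈ Aff n R := by
  intro i
  refine le_antisymm (h i) (Nat.one_le_iff_ne_zero.2 fun h0 => ?_)
  rw [totalDegree_eq_zero_iff_eq_C, ← apply_C g] at h0
  have hX := congrArg totalDegree (g.injective h0)
  simp at hX

lemma mem_Aff_iff {g : GA n R} :
    g ∈ Aff n R ↔ restrictTotalDegree (Fin n) R 1 ≤
      (restrictTotalDegree (Fin n) R 1).comap g.toLinearMap := by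
  constructor
  · intro hg f hf
    refine mem_of_totalDegree_le_one (s := Set.univ) ?_ (fun i _ => ?_)
      (by rw [supported_univ]; trivial) ((mem_restrictTotalDegree _ _ _).1 hf) <;>
    simp [mem_restrictTotalDegree, (hg _).le]
  · intro h
    refine mem_Aff_of_totalDegree_le_one fun i => ?_
    exact (mem_restrictTotalDegree _ _ _).1 (h ((mem_restrictTotalDegree _ _ _).2 (by simp)))

end GA

lemma elementary_mem_Aff {i : Fin n} {u : Rˣ} {f : MvPolynomial (Fin n) R}
    {hf : f ∈ supported R {i}ᶜ} (hdeg : f.totalDegree ≤ 1) : elementary i u f hf ∈ Aff n R := by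
  refine GA.mem_Aff_of_totalDegree_le_one fun j => ?_
  rcases eq_or_ne j i with rfl | hj
  · rw [elementary_X_self, ← smul_eq_C_mul]
    exact (totalDegree_add _ _).trans (max_le ((totalDegree_smul_le _ _).trans (by simp)) hdeg)
  · simp [elementary_X_of_ne hj]

lemma diagonal_mem_Aff (t : Fin n → Rˣ) : diagonal t ∈ Aff n R := by
  refine GA.mem_Aff_of_totalDegree_le_one fun j => ?_
  rw [diagonal_X, ← smul_eq_C_mul]
  exact (totalDegree_smul_le _ _).trans (by simp)

lemma renameEquiv_mem_Aff (e : Equiv.Perm (Fin n)) : renameEquiv R e ∈ Aff n R :=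
  fun i => by simp

/-- The affine automorphisms, as a subgroup of `GA n K`. -/
def affineSubgroup (n : ℕ) (K : Type*) [Field K] : Subgroup (GA n K) where
  carrier := Aff n K
  mul_mem' hg hh := by
    rw [GA.mem_Aff_iff] at *
    exact fun f hf => hg (hh hf)
  one_mem' := GA.mem_Aff_of_totalDegree_le_one fun i => by simp
  inv_mem' := by
    intro g hg
    rw [GA.mem_Aff_iff] at *
    have hmap : (restrictTotalDegree (Fin n) K 1).map g.toLinearMap =
        restrictTotalDegree (Fin n) K 1 :=
      Submodule.eq_of_le_of_finrank_eq (Submodule.map_le_iff_le_comap.2 hg)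
        (LinearEquiv.finrank_map_eq g.toLinearEquiv _)
    intro f hf
    obtain ⟨w, hw, rfl⟩ := hmap.ge hf
    simpa [← AlgEquiv.mul_apply] using hw

end Affine

section ShearSpace

variable {K : Type*} [Field K] {n : ℕ} {H : Subgroup (GA n K)}

/-- The polynomials `f` for which the shear `x_i ↦ x_i + f` is defined and lies in `H`; they form
a subspace because `H` contains the translations and dilations of the variable `x_i`. -/
def shearSpace (hH : Aff n K ⊆ H) (i : Fin n) : Submodule K (MvPolynomial (Fin n) K) where
  carrier := {f | ∃ hf : f ∈ supported K {i}ᶜ, elementary i 1 f hf ∈ H}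
  add_mem' := by
    rintro f g ⟨hf, hfH⟩ ⟨hg, hgH⟩
    refine ⟨add_mem hf hg, ?_⟩
    simpa [elementary_mul] using mul_mem hfH hgH
  zero_mem' := ⟨zero_mem _, hH (elementary_mem_Aff (by simp))⟩
  smul_mem' := by
    rintro c f ⟨hf, hfH⟩
    refine ⟨Subalgebra.smul_mem _ hf c, ?_⟩
    rcases eq_or_ne c 0 with rfl | hc
    · exact hH (elementary_mem_Aff (by simp))
    · have hd : elementary i (Units.mk0 c hc)⁻¹ 0 (zero_mem _) ∈ H :=
        hH (elementary_mem_Aff (by simp))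
      rw [← Subgroup.mul_mem_cancel_right H hd]
      simpa [elementary_mul, smul_eq_C_mul, ← mul_assoc, ← C_mul, inv_mul_cancel₀ hc]
        using mul_mem hd hfH

variable {hH : Aff n K ⊆ H} {i j : Fin n}

lemma mem_supported_of_mem_shearSpace {f : MvPolynomial (Fin n) K} (hf : f ∈ shearSpace hH i) :
    f ∈ supported K {i}ᶜ :=
  hf.1

lemma mem_shearSpace_of_totalDegree_le_one {f : MvPolynomial (Fin n) K}
    (hf : f ∈ supported K {i}ᶜ) (hdeg : f.totalDegree ≤ 1) : f ∈ shearSpace hH i :=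
  ⟨hf, hH (elementary_mem_Aff hdeg)⟩

lemma elementary_mem_iff {u : Kˣ} {f : MvPolynomial (Fin n) K} {hf : f ∈ supported K {i}ᶜ} :
    elementary i u f hf ∈ H ↔ f ∈ shearSpace hH i := by
  have hd : elementary i u 0 (zero_mem _) ∈ H := hH (elementary_mem_Aff (by simp))
  have hmul : elementary i u f hf = elementary i u 0 (zero_mem _) * elementary i 1 f hf := by
    simp [elementary_mul]
  rw [hmul, Subgroup.mul_mem_cancel_left H hd]
  exact ⟨fun h => ⟨hf, h⟩, fun h => h.2⟩

/-- If `S_p` denotes the shear along `p`, then `S_{u⁻¹ h(f)} h = h S_f`. -/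
lemma map_mem_shearSpace {h : GA n K} (hh : h ∈ H) {u : Kˣ} {g : MvPolynomial (Fin n) K}
    (hg : g ∈ supported K {j}ᶜ) (hi : h (X i) = C (u : K) * X j + g)
    (hne : ∀ k, k ≠ i → h (X k) ∈ supported K {j}ᶜ) {f : MvPolynomial (Fin n) K}
    (hf : f ∈ shearSpace hH i) : h f ∈ shearSpace hH j := by
  have hhf : h f ∈ supported K {j}ᶜ :=
    GA.mapsTo_supported hne (mem_supported_of_mem_shearSpace hf)
  have hcf : C ((u⁻¹ : Kˣ) : K) * h f ∈ supported K {j}ᶜ := mul_mem (C_mem_supported _ _) hhf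
  have hconj : elementary j 1 _ hcf * h = h * elementary i 1 f hf.1 := by
    refine GA.ext_X fun k => ?_
    rcases eq_or_ne k i with rfl | hk
    · simp only [AlgEquiv.mul_apply, hi, map_add, map_mul, GA.apply_C, elementary_X_self,
        elementary_apply_of_mem_supported hg, Units.val_one, map_one, one_mul, mul_add,
        ← mul_assoc, ← C_mul, Units.mul_inv]
      ring
    · simp only [AlgEquiv.mul_apply, elementary_X_of_ne hk,
        elementary_apply_of_mem_supported (hne k hk)]
  have hmem : C ((u⁻¹ : Kˣ) : K) * h f ∈ shearSpace hH j := by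
    rw [← elementary_mem_iff (u := 1) (hf := hcf), ← Subgroup.mul_mem_cancel_right H hh, hconj]
    exact mul_mem hh hf.2
  simpa [smul_eq_C_mul, ← mul_assoc, ← C_mul] using (shearSpace hH j).smul_mem (u : K) hmem

lemma rename_mem_shearSpace (e : Equiv.Perm (Fin n)) {f : MvPolynomial (Fin n) K}
    (hf : f ∈ shearSpace hH i) : rename e f ∈ shearSpace hH (e i) :=
  map_mem_shearSpace (h := renameEquiv K e) (hH (renameEquiv_mem_Aff e)) (u := 1) (zero_mem _)
    (by simp) (fun k hk => by simpa using hk) hf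

lemma monomial_mem_shearSpace [Infinite K] {f : MvPolynomial (Fin n) K}
    (hf : f ∈ shearSpace hH i) {m : Fin n →₀ ℕ} (hm : m ∈ f.support) :
    monomial m 1 ∈ shearSpace hH i := by
  have hcoeff : monomial m (coeff m f) ∈ shearSpace hH i := by
    refine mem_of_forall_sum_prod_pow_smul_mem _ f.support id Function.injective_id.injOn
      (fun m => monomial m (coeff m f)) (fun t ht => ?_) m hm
    have hdiag := map_mem_shearSpace
      (hH (diagonal_mem_Aff fun k => Units.mk0 (t k) (ht k))) (zero_mem _)
      (by rw [diagonal_X, add_zero]) (fun k hk => ?_) hf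
    · rw [f.as_sum, map_sum] at hdiag
      simpa only [diagonal_monomial, Units.val_mk0, id] using hdiag
    · rw [diagonal_X]
      exact mul_mem (C_mem_supported _ _) (by simpa using hk)
  simpa [smul_monomial, mem_support_iff.1 hm] using
    (shearSpace hH i).smul_mem (coeff m f)⁻¹ hcoeff

lemma pow_mul_X_pow_mul_mem_shearSpace [CharZero K] (hji : j ≠ i) {c r : MvPolynomial (Fin n) K}
    (hc : c ∈ shearSpace hH j) (hci : c ∈ supported K {i}ᶜ) (hr : r ∈ supported K {j}ᶜ) {a b : ℕ}
    (hX : X j ^ (a + b) * r ∈ shearSpace hH i) : c ^ a * X j ^ b * r ∈ shearSpace hH i := by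
  have hadd (t : K) : (t • c + X j) ^ (a + b) * r ∈ shearSpace hH i := by
    have htc : t • c ∈ shearSpace hH j := (shearSpace hH j).smul_mem t hc
    have hmap := map_mem_shearSpace (i := i) (j := i) htc.2 (u := 1) (zero_mem _)
      (by simp [elementary_X_of_ne hji.symm]) (fun k hk => ?_) hX
    · simpa [elementary_apply_of_mem_supported hr, add_comm] using hmap
    · rcases eq_or_ne k j with rfl | hkj
      · simpa using add_mem (X_mem_supported.2 hk) (Subalgebra.smul_mem _ hci t)
      · simpa [elementary_X_of_ne hkj] using hk
  have hcoeff := mem_of_forall_sum_prod_pow_smul_mem (shearSpace hH i) (Finset.range (a + b + 1))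
    (Finsupp.single ()) (Finsupp.single_injective ()).injOn
    (fun m => ((a + b).choose m : K) • (c ^ m * X j ^ (a + b - m) * r))
    (fun t _ => by
      convert hadd (t ()) using 1
      rw [add_pow, Finset.sum_mul]
      refine Finset.sum_congr rfl fun m _ => ?_
      have hprod : ((Finsupp.single () m).prod fun i e => t i ^ e) = t () ^ m := by simp
      simp only [hprod, smul_eq_C_mul, map_natCast, map_pow]
      ring) a (Finset.mem_range.2 (by omega))
  have hchoose : ((a + b).choose a : K) ≠ 0 :=
    Nat.cast_ne_zero.2 (Nat.choose_pos (Nat.le_add_right a b)).ne'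
  simpa [hchoose] using (shearSpace hH i).smul_mem ((a + b).choose a : K)⁻¹ hcoeff

lemma one_mem_shearSpace : (1 : MvPolynomial (Fin n) K) ∈ shearSpace hH i :=
  mem_shearSpace_of_totalDegree_le_one (one_mem _) (by simp)

lemma X_mem_shearSpace (hji : j ≠ i) : (X j : MvPolynomial (Fin n) K) ∈ shearSpace hH i :=
  mem_shearSpace_of_totalDegree_le_one (by simpa using hji) (by simp)

lemma X_pow_mem_shearSpace_of_ne {k l : Fin n} (hji : j ≠ i) (hlk : l ≠ k) {m : ℕ}
    (hX : X j ^ m ∈ shearSpace hH i) : X l ^ m ∈ shearSpace hH k := by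
  have hne : k ≠ Equiv.swap i k j := by
    rw [ne_comm, ne_eq, Equiv.swap_apply_eq_iff, Equiv.swap_apply_right]
    exact hji
  have hrename :=
    rename_mem_shearSpace (Equiv.swap (Equiv.swap i k j) l * Equiv.swap i k) hX
  simpa [Equiv.swap_apply_of_ne_of_ne hne hlk.symm] using hrename

variable [CharZero K]

lemma X_pow_mem_shearSpace_of_monomial (hji : j ≠ i) (m : Fin n →₀ ℕ) (hmi : m i = 0) (b : ℕ)
    (hm : X j ^ b * monomial m 1 ∈ shearSpace hH i) : X j ^ (b + m.degree) ∈ shearSpace hH i := by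
  induction m using Finsupp.induction generalizing b with
  | zero => simpa using hm
  | single_add k e m hk he ih =>
    have hki : k ≠ i := by
      rintro rfl
      exact he (by simpa using (Nat.add_eq_zero_iff.1 hmi).1)
    have hmi' : m i = 0 := by simpa [hki] using hmi
    rw [map_add, Finsupp.degree_single, ← add_assoc]
    refine ih hmi' _ ?_
    rw [monomial_single_add_one, ← mul_assoc] at hm
    rcases eq_or_ne k j with rfl | hkj
    · rwa [pow_add]
    · have hr : X j ^ b * monomial m 1 ∈ supported K {k}ᶜ :=
        mul_mem (pow_mem (by simpa using hkj.symm) b)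
          (monomial_one_mem_supported_compl (Finsupp.notMem_support_iff.1 hk))
      have hpol := pow_mul_X_pow_mul_mem_shearSpace (a := e) (b := 0) hki
        (X_mem_shearSpace hkj.symm) (by simpa using hji) hr (by convert hm using 1; ring)
      convert hpol using 1
      ring

lemma monomial_mem_shearSpace_of_X_pow (hji : j ≠ i) (m : Fin n →₀ ℕ) (hmi : m i = 0)
    (hmj : m j = 0) (b : ℕ) (hX : X j ^ (b + m.degree) ∈ shearSpace hH i) :
    X j ^ b * monomial m 1 ∈ shearSpace hH i := by
  induction m using Finsupp.induction generalizing b with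
  | zero => simpa using hX
  | single_add k e m _ he ih =>
    have hki : k ≠ i := by
      rintro rfl
      exact he (by simpa using (Nat.add_eq_zero_iff.1 hmi).1)
    have hkj : k ≠ j := by
      rintro rfl
      exact he (by simpa using (Nat.add_eq_zero_iff.1 hmj).1)
    have hmi' : m i = 0 := by simpa [hki] using hmi
    have hmj' : m j = 0 := by simpa [hkj] using hmj
    rw [map_add, Finsupp.degree_single, ← add_assoc] at hX
    have hpol := pow_mul_X_pow_mul_mem_shearSpace (a := e) (b := b) hji (X_mem_shearSpace hkj)
      (X_mem_supported.2 hki) (monomial_one_mem_supported_compl hmj')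
      (by simpa [add_comm] using ih hmi' hmj' _ hX)
    rw [monomial_single_add_one]
    convert hpol using 1
    ring

lemma X_pow_mem_shearSpace_of_le (hji : j ≠ i) {a b : ℕ} (hab : a ≤ b)
    (hX : X j ^ b ∈ shearSpace hH i) : X j ^ a ∈ shearSpace hH i := by
  obtain ⟨c, rfl⟩ := Nat.exists_eq_add_of_le' hab
  simpa using pow_mul_X_pow_mul_mem_shearSpace (a := c) (b := a) (r := 1) hji one_mem_shearSpace
    (one_mem _) (one_mem _) (by simpa using hX)

lemma X_pow_mem_shearSpace (hn : 3 ≤ n) (hji : j ≠ i) {m : ℕ} (hm : 2 ≤ m)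
    (hX : X j ^ m ∈ shearSpace hH i) (N : ℕ) : X j ^ N ∈ shearSpace hH i := by
  obtain ⟨k, -, hk⟩ := Finset.exists_mem_notMem_of_card_lt_card
    (s := {i, j}) (t := Finset.univ) (Finset.card_le_two.trans_lt (by rwa [Finset.card_fin]))
  simp only [Finset.mem_insert, Finset.mem_singleton, not_or] at hk
  have double {a : ℕ} (ha : 2 ≤ a) (haX : X j ^ a ∈ shearSpace hH i) :
      X j ^ (a * 2) ∈ shearSpace hH i := by
    have hsq : X j ^ (2 + 0) * 1 ∈ shearSpace hH i := by
      simpa using X_pow_mem_shearSpace_of_le hji ha haX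
    have hk2 := pow_mul_X_pow_mul_mem_shearSpace hji (X_pow_mem_shearSpace_of_ne hji hk.2 haX)
      (pow_mem (X_mem_supported.2 hk.1) a) (one_mem _) hsq
    exact X_pow_mem_shearSpace_of_ne hk.1 hji (by simpa [← pow_mul] using hk2)
  obtain ⟨M, hNM, -, hM⟩ : ∃ M, N ≤ M ∧ 2 ≤ M ∧ X j ^ M ∈ shearSpace hH i := by
    induction N with
    | zero => exact ⟨m, m.zero_le, hm, hX⟩
    | succ N ih =>
      obtain ⟨M, hNM, h2M, hM⟩ := ih
      exact ⟨M * 2, by omega, by omega, double h2M hM⟩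
  exact X_pow_mem_shearSpace_of_le hji hNM hM

theorem mem_shearSpace_of_one_lt_totalDegree (hn : 3 ≤ n) {f : MvPolynomial (Fin n) K}
    (hf : f ∈ shearSpace hH i) (hdeg : 1 < f.totalDegree) {g : MvPolynomial (Fin n) K}
    (hg : g ∈ supported K {j}ᶜ) : g ∈ shearSpace hH j := by
  have exists_ne (i : Fin n) : ∃ k, k ≠ i :=
    have : Nontrivial (Fin n) := Fin.nontrivial_iff_two_le.2 (by omega)
    _root_.exists_ne i
  obtain ⟨m, hm, hm1⟩ := Finset.lt_sup_iff.1 hdeg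
  obtain ⟨k, hki⟩ := exists_ne i
  obtain ⟨l, hlj⟩ := exists_ne j
  have hXk : X k ^ m.degree ∈ shearSpace hH i := by
    simpa using X_pow_mem_shearSpace_of_monomial hki m
      (apply_eq_zero_of_mem_support (mem_supported_of_mem_shearSpace hf) hm) 0
      (by simpa using monomial_mem_shearSpace hf hm)
  have hXl (N : ℕ) : X l ^ N ∈ shearSpace hH j :=
    X_pow_mem_shearSpace hn hlj hm1 (X_pow_mem_shearSpace_of_ne hki hlj hXk) N
  rw [g.as_sum]
  refine sum_mem fun m hm => ?_
  have hmj := apply_eq_zero_of_mem_support hg hm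
  have hsplit := monomial_mem_shearSpace_of_X_pow hlj (m.erase l)
    (by simp [Finsupp.erase_apply, hmj]) Finsupp.erase_same (m l) (hXl _)
  rw [← monomial_single_add_one, Finsupp.single_add_erase] at hsplit
  simpa [smul_monomial] using (shearSpace hH j).smul_mem (coeff m g) hsplit

end ShearSpace

section Triangular

lemma elementary_inv_apply_of_mem_supported {R : Type*} [CommRing R] {n : ℕ} {i : Fin n} {u : Rˣ}
    {f : MvPolynomial (Fin n) R} {hf : f ∈ supported R {i}ᶜ} {p : MvPolynomial (Fin n) R}
    (hp : p ∈ supported R {i}ᶜ) : (elementary i u f hf)⁻¹ p = p :=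
  (elementary i u f hf).symm_apply_eq.2 (elementary_apply_of_mem_supported hp).symm

lemma elementary_inv_mul_apply_X_self {R : Type*} [CommRing R] {n : ℕ} {i : Fin n} {u : Rˣ}
    {f : MvPolynomial (Fin n) R} {hf : f ∈ supported R {i}ᶜ} {g : GA n R}
    (hg : g (X i) = C (u : R) * X i + f) : ((elementary i u f hf)⁻¹ * g) (X i) = X i :=
  (elementary i u f hf).symm_apply_eq.2 (hg.trans elementary_X_self.symm)

lemma apply_X_mem_supported_compl_of_mem_BA {R : Type*} [CommRing R] [Nontrivial R] {n : ℕ}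
    {β : GA n R} (hβ : β ∈ BA n R) {i j : Fin n} (hij : i < j) :
    β (X j) ∈ supported R {i}ᶜ := by
  obtain ⟨u, f, hf, hj⟩ := hβ j
  rw [hj]
  exact add_mem (mul_mem (C_mem_supported _ _) (X_mem_supported.2 hij.ne'))
    (supported_mono (fun k hk => (hij.trans hk).ne') hf)

/-- Peeling off the variables in the order `x_0, x_1, …` never disturbs the variables that
remain. -/
theorem BA_subset_of_elementary_mem {R : Type*} [CommRing R] [Nontrivial R] {n : ℕ}
    {H : Subgroup (GA n R)} (hH : ∀ i u f hf, elementary i u f hf ∈ H) : BA n R ⊆ H := by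
  suffices h : ∀ k : Fin (n + 1), ∀ β ∈ BA n R,
      (∀ j : Fin n, j.castSucc < k → β (X j) = X j) → β ∈ H from
    fun β hβ => h 0 β hβ fun j hj => absurd hj (Fin.not_lt_zero _)
  intro k
  induction k using Fin.reverseInduction with
  | last =>
    intro β _ hfix
    have hβ : β = 1 := GA.ext_X fun j => hfix j (Fin.castSucc_lt_last j)
    exact hβ ▸ one_mem H
  | cast i ih =>
    intro β hβ hfix
    obtain ⟨u, f, hf, hi⟩ := hβ i
    set e := elementary i u f (supported_Ioi_le_compl i hf) with he
    have hself : (e⁻¹ * β) (X i) = X i := elementary_inv_mul_apply_X_self hi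
    have hgt {j : Fin n} (hij : i < j) : (e⁻¹ * β) (X j) = β (X j) := by
      rw [AlgEquiv.mul_apply]
      exact elementary_inv_apply_of_mem_supported (apply_X_mem_supported_compl_of_mem_BA hβ hij)
    have hlt {j : Fin n} (hji : j < i) : (e⁻¹ * β) (X j) = X j := by
      rw [AlgEquiv.mul_apply, hfix j hji]
      exact elementary_inv_apply_of_mem_supported (X_mem_supported.2 hji.ne)
    have hmem : e⁻¹ * β ∈ H := by
      refine ih _ (fun j => ?_) fun j hj => ?_
      · rcases lt_or_ge i j with hij | hji
        · rw [hgt hij]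
          exact hβ j
        · refine ⟨1, 0, zero_mem _, ?_⟩
          rcases hji.eq_or_lt with rfl | hji
          · simpa using hself
          · simpa using hlt hji
      · rcases (Fin.castSucc_lt_succ_iff.1 hj).eq_or_lt with rfl | hji
        exacts [hself, hlt hji]
    rw [← mul_inv_cancel_left e β]
    exact mul_mem (hH i u f _) hmem

variable {K : Type*} [Field K] {n : ℕ} {H : Subgroup (GA (n + 1) K)} {hH : Aff (n + 1) K ⊆ H}

lemma exists_mem_shearSpace_one_lt_totalDegree {β : GA (n + 1) K} (hβ : β ∈ H)
    (hB : β ∈ BA (n + 1) K) (hA : β ∉ Aff (n + 1) K) :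
    ∃ f ∈ shearSpace hH 0, 1 < f.totalDegree := by
  have hne (k : Fin (n + 1)) (hk : k ≠ 0) : β (X k) ∈ supported K {0}ᶜ :=
    apply_X_mem_supported_compl_of_mem_BA hB (Fin.pos_of_ne_zero hk)
  obtain ⟨u, f, hf, h0⟩ := hB 0
  replace hf := supported_Ioi_le_compl 0 hf
  by_contra! hle
  have hβle (k : Fin (n + 1)) (hk : k ≠ 0) : (β (X k)).totalDegree ≤ 1 :=
    hle _ (map_mem_shearSpace hβ hf h0 hne (X_mem_shearSpace hk))
  set e := elementary 0 u f hf
  have ha : e⁻¹ * β ∈ Aff (n + 1) K := by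
    refine GA.mem_Aff_of_totalDegree_le_one fun k => ?_
    rcases eq_or_ne k 0 with rfl | hk
    · simp [e, elementary_inv_mul_apply_X_self h0]
    · rw [AlgEquiv.mul_apply, elementary_inv_apply_of_mem_supported (hne k hk)]
      exact hβle k hk
  have he : e ∈ H := by simpa using mul_mem hβ (inv_mem (hH ha))
  have he' : e ∈ Aff (n + 1) K := elementary_mem_Aff (hle f (elementary_mem_iff.1 he))
  have hmul : e * (e⁻¹ * β) ∈ affineSubgroup (n + 1) K := mul_mem he' ha
  rw [mul_inv_cancel_left] at hmul
  exact hA hmul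

theorem BA_subset_of_mem [CharZero K] (hH : Aff (n + 1) K ⊆ H) (hn : 2 ≤ n) {β : GA (n + 1) K}
    (hβ : β ∈ H) (hB : β ∈ BA (n + 1) K) (hA : β ∉ Aff (n + 1) K) : BA (n + 1) K ⊆ H := by
  obtain ⟨f, hf, hdeg⟩ := exists_mem_shearSpace_one_lt_totalDegree (hH := hH) hβ hB hA
  exact BA_subset_of_elementary_mem fun i u g hg =>
    elementary_mem_iff.2 (mem_shearSpace_of_one_lt_totalDegree (by omega) hf hdeg hg)

end Triangular

section FiniteDifferences

variable {L : Type*} [CommRing L]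

lemma coeff_sub_taylor (c : L) {Q : Polynomial L} {n : ℕ} (hQ : Q.natDegree ≤ n + 1) :
    (Q - Polynomial.taylor c Q).coeff n = -((n + 1) * Q.coeff (n + 1) * c) := by
  have hdeg : (Polynomial.hasseDeriv n Q).natDegree < 2 := by
    have := Polynomial.natDegree_hasseDeriv_le Q n
    omega
  rw [Polynomial.coeff_sub, Polynomial.taylor_coeff, Polynomial.eval_eq_sum_range' hdeg,
    Finset.sum_range_succ, Finset.sum_range_one, Polynomial.hasseDeriv_coeff,
    Polynomial.hasseDeriv_coeff, add_comm 1 n, Nat.choose_symm_add]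
  simp

lemma natDegree_sub_taylor_le (c : L) {Q : Polynomial L} {n : ℕ} (hQ : Q.natDegree ≤ n + 1) :
    (Q - Polynomial.taylor c Q).natDegree ≤ n := by
  refine Polynomial.natDegree_le_iff_coeff_eq_zero.2 fun N hN => ?_
  have hdeg : (Polynomial.hasseDeriv N Q).natDegree < 1 := by
    have := Polynomial.natDegree_hasseDeriv_le Q N
    omega
  rw [Polynomial.coeff_sub, Polynomial.taylor_coeff, Polynomial.eval_eq_sum_range' hdeg,
    Finset.sum_range_one, Polynomial.hasseDeriv_coeff]
  simp

lemma natDegree_sub_taylor [IsDomain L] [CharZero L] {c : L} (hc : c ≠ 0) {Q : Polynomial L}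
    {n : ℕ} (hQ : Q.natDegree = n + 1) : (Q - Polynomial.taylor c Q).natDegree = n := by
  refine le_antisymm (natDegree_sub_taylor_le c hQ.le) (Polynomial.le_natDegree_of_ne_zero ?_)
  have hlead : Q.coeff (n + 1) ≠ 0 := by
    rw [← hQ, Polynomial.coeff_natDegree, Polynomial.leadingCoeff_ne_zero]
    rintro rfl
    simp at hQ
  rw [coeff_sub_taylor c hQ.le]
  exact neg_ne_zero.2 (mul_ne_zero (mul_ne_zero n.cast_add_one_ne_zero hlead) hc)

lemma natDegree_iterate_sub_taylor [IsDomain L] [CharZero L] {c : L} (hc : c ≠ 0) (n m : ℕ)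
    {Q : Polynomial L} (hQ : Q.natDegree = m + n) :
    ((fun P => P - Polynomial.taylor c P)^[n] Q).natDegree = m := by
  induction n generalizing Q with
  | zero => exact hQ
  | succ n ih => exact ih (natDegree_sub_taylor hc hQ)

lemma commute_sub_taylor (c d a : L) : Function.Commute
    (fun P : Polynomial L => P - Polynomial.taylor c P)
    fun P => Polynomial.C a * (P - Polynomial.taylor d P) :=
  fun P => by
    simp only [Polynomial.taylor_mul, Polynomial.taylor_C, map_sub, Polynomial.taylor_taylor,
      add_comm d c]
    ring

lemma C_mul_sub_taylor_of_natDegree_le_one (a c : L) {Q : Polynomial L} (hQ : Q.natDegree ≤ 1) :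
    Polynomial.C a * (Q - Polynomial.taylor c Q) = Polynomial.C (-(a * Q.coeff 1 * c)) := by
  obtain ⟨b, d, rfl⟩ := Polynomial.exists_eq_X_add_C_of_natDegree_le_one hQ
  simp only [map_add, Polynomial.taylor_mul, Polynomial.taylor_C, Polynomial.taylor_X,
    add_sub_add_right_eq_sub, Polynomial.coeff_add, Polynomial.coeff_mul_X,
    Polynomial.coeff_C_zero, Polynomial.coeff_C_succ, add_zero, map_neg, map_mul]
  ring

end FiniteDifferences

section ShearAlong

variable {R A : Type*} [CommRing R] [CommRing A] [Algebra R A]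

/-- The automorphism `φ` acts on `v` as the translation `v ↦ v + t` and on `u` as the shear
`u ↦ u + f(v)`. -/
structure IsShearAlong (v u : A) (t : R) (f : Polynomial R) (φ : A ≃ₐ[R] A) : Prop where
  apply_base : φ v = v + algebraMap R A t
  apply_fibre : φ u = u + Polynomial.aeval v f

lemma aeval_add_algebraMap (v : A) (t : R) (f : Polynomial R) :
    Polynomial.aeval (v + algebraMap R A t) f = Polynomial.aeval v (Polynomial.taylor t f) := by
  simp [Polynomial.taylor_apply, Polynomial.aeval_comp]

lemma apply_aeval_of_apply_eq_add_algebraMap {v : A} {t : R} {φ : A ≃ₐ[R] A}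
    (hv : φ v = v + algebraMap R A t) (f : Polynomial R) :
    φ (Polynomial.aeval v f) = Polynomial.aeval v (Polynomial.taylor t f) := by
  rw [← aeval_add_algebraMap, ← hv]
  exact (Polynomial.aeval_algHom_apply φ v f).symm

namespace IsShearAlong

variable {v u : A} {t s : R} {f g : Polynomial R} {φ ψ : A ≃ₐ[R] A}

lemma mul (hφ : IsShearAlong v u t f φ) (hψ : IsShearAlong v u s g ψ) :
    IsShearAlong v u (t + s) (f + Polynomial.taylor t g) (φ * ψ) where
  apply_base := by
    rw [AlgEquiv.mul_apply, hψ.apply_base, map_add, hφ.apply_base, AlgEquiv.commutes, map_add,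
      add_assoc]
  apply_fibre := by
    rw [AlgEquiv.mul_apply, hψ.apply_fibre, map_add, hφ.apply_fibre,
      apply_aeval_of_apply_eq_add_algebraMap hφ.apply_base, map_add, add_assoc]

lemma inv (hφ : IsShearAlong v u t f φ) :
    IsShearAlong v u (-t) (-Polynomial.taylor (-t) f) φ⁻¹ where
  apply_base := φ.symm_apply_eq.2 (by simp [hφ.apply_base])
  apply_fibre := φ.symm_apply_eq.2 (by
    rw [map_add, hφ.apply_fibre, apply_aeval_of_apply_eq_add_algebraMap hφ.apply_base]
    simp [Polynomial.taylor_taylor])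

lemma commutator (hφ : IsShearAlong v u t f φ) (hψ : IsShearAlong v u s 0 ψ) :
    IsShearAlong v u 0 (f - Polynomial.taylor s f) (φ * ψ * φ⁻¹ * ψ⁻¹) := by
  have h := ((hφ.mul hψ).mul hφ.inv).mul hψ.inv
  convert h using 1
  · ring
  · simp [Polynomial.taylor_taylor, sub_eq_add_neg]

lemma exists_iterate_commutator {Γ : Subgroup (A ≃ₐ[R] A)} (hφΓ : φ ∈ Γ)
    (hφ : IsShearAlong v u t f φ) (hψΓ : ψ ∈ Γ) (hψ : IsShearAlong v u s 0 ψ) (n : ℕ) :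
    ∃ χ ∈ Γ, IsShearAlong v u 0 ((fun P => P - Polynomial.taylor s P)^[n + 1] f) χ := by
  induction n with
  | zero =>
    exact ⟨_, mul_mem (mul_mem (mul_mem hφΓ hψΓ) (inv_mem hφΓ)) (inv_mem hψΓ), hφ.commutator hψ⟩
  | succ n ih =>
    obtain ⟨χ, hχΓ, hχ⟩ := ih
    rw [Function.iterate_succ_apply']
    exact ⟨_, mul_mem (mul_mem (mul_mem hχΓ hψΓ) (inv_mem hχΓ)) (inv_mem hψΓ), hχ.commutator hψ⟩

lemma of_apply_eq_self {L A : Type*} [Field L] [CommRing A] [Algebra L A] {v u : A} {t p : L}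
    (hp : p ≠ 0) {Q : Polynomial L} {φ : A ≃ₐ[L] A} (hv : φ v = v + algebraMap L A t)
    (hfix : φ (algebraMap L A p * u + Polynomial.aeval v Q) =
      algebraMap L A p * u + Polynomial.aeval v Q) :
    IsShearAlong v u t (Polynomial.C p⁻¹ * (Q - Polynomial.taylor t Q)) φ where
  apply_base := hv
  apply_fibre := by
    have hinv : algebraMap L A p⁻¹ * algebraMap L A p = 1 := by
      rw [← map_mul, inv_mul_cancel₀ hp, map_one]
    rw [map_add, map_mul, φ.commutes, apply_aeval_of_apply_eq_add_algebraMap hv] at hfix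
    rw [map_mul, map_sub, Polynomial.aeval_C]
    linear_combination algebraMap L A p⁻¹ * hfix - (φ u - u) * hinv

/-- Commutators with `ψ` lower the degree of the polynomial of a shear; they are taken until only
a translation of `u` is left. -/
lemma exists_translation {L A : Type*} [Field L] [CharZero L] [CommRing A] [Algebra L A] {v u : A}
    {s p : L} {Γ : Subgroup (A ≃ₐ[L] A)} {ψ : A ≃ₐ[L] A} (hψΓ : ψ ∈ Γ)
    (hψ : IsShearAlong v u s 0 ψ) (hs : s ≠ 0) (hp : p ≠ 0) {Q : Polynomial L}
    (hQ : 2 ≤ Q.natDegree) :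
    ∃ r ≠ 0, ∀ t, ∀ φ ∈ Γ, φ v = v + algebraMap L A t →
      φ (algebraMap L A p * u + Polynomial.aeval v Q) =
        algebraMap L A p * u + Polynomial.aeval v Q →
      ∃ χ ∈ Γ, χ v = v ∧ χ u = u + algebraMap L A (t * r) := by
  obtain ⟨n, hn⟩ : ∃ n, Q.natDegree = 1 + (n + 1) := ⟨Q.natDegree - 2, by omega⟩
  set P := (fun f => f - Polynomial.taylor s f)^[n + 1] Q
  have hP : P.natDegree = 1 := natDegree_iterate_sub_taylor hs (n + 1) 1 hn
  have hlead : P.coeff 1 ≠ 0 := by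
    rw [← hP, Polynomial.coeff_natDegree, Polynomial.leadingCoeff_ne_zero]
    rintro h0
    simp [h0] at hP
  refine ⟨-(p⁻¹ * P.coeff 1), by simp [hp, hlead], fun t φ hφΓ hφv hφ => ?_⟩
  obtain ⟨χ, hχΓ, hχ⟩ := exists_iterate_commutator hφΓ (of_apply_eq_self hp hφv hφ) hψΓ hψ n
  rw [((commute_sub_taylor s t p⁻¹).iterate_left (n + 1)).eq,
    C_mul_sub_taylor_of_natDegree_le_one _ _ hP.le] at hχ
  refine ⟨χ, hχΓ, by simpa only [map_zero, add_zero] using hχ.apply_base, ?_⟩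
  rw [hχ.apply_fibre, Polynomial.aeval_C]
  congr 2
  ring

end IsShearAlong

end ShearAlong

section GenericFibre

variable (K : Type*) [Field K]

/-- The field `K(z)`, over which an automorphism fixing `z` becomes an automorphism of the affine
plane. -/
abbrev RatFn : Type _ := FractionRing (Polynomial K)

/-- The variable `z` as an element of `K(z)`. -/
def zFn : RatFn K := algebraMap (Polynomial K) (RatFn K) Polynomial.X

/-- The embedding of `K[x,y,z]` into `K(z)[x,y]`. -/
def toRatFn : MvPolynomial (Fin 3) K →ₐ[K] MvPolynomial (Fin 2) (RatFn K) :=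
  (mapAlgHom (Algebra.algHom K (Polynomial K) (RatFn K))).comp (overZ K)

variable {K}

lemma toRatFn_apply (f : MvPolynomial (Fin 3) K) :
    toRatFn K f = map (algebraMap (Polynomial K) (RatFn K)) (overZ K f) :=
  rfl

@[simp]
lemma toRatFn_X_zero : toRatFn K (X 0) = X 0 := by
  simp [toRatFn_apply, overZ]

@[simp]
lemma toRatFn_X_one : toRatFn K (X 1) = X 1 := by
  simp [toRatFn_apply, overZ]

@[simp]
lemma toRatFn_X_two : toRatFn K (X 2) = C (zFn K) := by
  simp [toRatFn_apply, overZ, zFn]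

lemma toRatFn_X_castSucc (i : Fin 2) : toRatFn K (X i.castSucc) = X i :=
  match i with
  | 0 => toRatFn_X_zero
  | 1 => toRatFn_X_one

lemma toRatFn_aeval_X_two (p : Polynomial K) :
    toRatFn K (Polynomial.aeval (X 2) p) = C (algebraMap (Polynomial K) (RatFn K) p) := by
  rw [← Polynomial.aeval_algHom_apply, toRatFn_X_two]
  induction p using Polynomial.induction_on' with
  | add p q hp hq => rw [map_add, hp, hq, map_add, map_add]
  | monomial n a =>
    rw [Polynomial.aeval_monomial, ← Polynomial.C_mul_X_pow_eq_monomial]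
    simp [zFn, IsScalarTower.algebraMap_apply K (RatFn K) (MvPolynomial (Fin 2) (RatFn K)),
      MvPolynomial.algebraMap_eq, IsScalarTower.algebraMap_apply K (Polynomial K) (RatFn K)]

lemma overZ_injective : Function.Injective (overZ K) := by
  let r : MvPolynomial (Fin 2) (Polynomial K) →+* MvPolynomial (Fin 3) K :=
    eval₂Hom (Polynomial.aeval (X 2 : MvPolynomial (Fin 3) K)).toRingHom ![X 0, X 1]
  have hr : r.comp (overZ K).toRingHom = RingHom.id _ := by
    refine ringHom_ext (fun c => ?_) fun j => ?_
    · simp [r, overZ, MvPolynomial.algebraMap_apply]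
    · match j with
      | 0 => simp [r, overZ]
      | 1 => simp [r, overZ]
      | 2 => simp [r, overZ]
  exact Function.LeftInverse.injective (g := r) (RingHom.congr_fun hr)

lemma toRatFn_injective : Function.Injective (toRatFn K) :=
  (map_injective _ (IsFractionRing.injective (Polynomial K) (RatFn K))).comp overZ_injective

lemma mem_supported_of_toRatFn_mem_supported {f : MvPolynomial (Fin 3) K} {s : Set (Fin 3)}
    (hs : 2 ∈ s) (h : toRatFn K f ∈ supported (RatFn K) (Fin.castSucc ⁻¹' s)) :
    f ∈ supported K s := by
  classical
  let π : MvPolynomial (Fin 3) K →ₐ[K] MvPolynomial (Fin 3) K :=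
    aeval fun j => if j ∈ s then X j else 0
  let π' : MvPolynomial (Fin 2) (RatFn K) →ₐ[RatFn K] MvPolynomial (Fin 2) (RatFn K) :=
    aeval fun i => if i.castSucc ∈ s then X i else 0
  have hcomm : (toRatFn K).comp π = (π'.restrictScalars K).comp (toRatFn K) := by
    refine algHom_ext fun j => ?_
    match j with
    | 0 => simp [π, π', apply_ite (toRatFn K)]
    | 1 => simp [π, π', apply_ite (toRatFn K)]
    | 2 => simp [π, π', hs, MvPolynomial.algebraMap_eq]
  have hfix : π' (toRatFn K f) = toRatFn K f :=
    algHom_eqOn_supported (φ := π') (ψ := AlgHom.id _ _) (fun i hi =>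
      (aeval_X _ i).trans (if_pos hi)) h
  have hf : π f = f := toRatFn_injective ((DFunLike.congr_fun hcomm f).trans hfix)
  rw [← hf]
  refine algHom_mapsTo_supported (s := Set.univ) (fun j _ => ?_) (by simp)
  by_cases hj : j ∈ s <;> simp [π, hj, X_mem_supported]

lemma aeval_X_mem_supported {R σ : Type*} [CommRing R] {s : Set σ} {i : σ} (hi : i ∈ s)
    (f : Polynomial R) : Polynomial.aeval (X i : MvPolynomial σ R) f ∈ supported R s :=
  Algebra.adjoin_mono (Set.singleton_subset_iff.2 (Set.mem_image_of_mem _ hi))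
    (Polynomial.aeval_mem_adjoin_singleton _ _)

/-- The automorphism `φ` of `K(z)[x,y]` restricts to the automorphism `g` of `K[x,y,z]`. -/
def Extends (φ : GA 2 (RatFn K)) (g : GA 3 K) : Prop :=
  ∀ f, φ (toRatFn K f) = toRatFn K (g f)

lemma exists_extends {g : GA 3 K} (hg : g (X 2) = X 2) : ∃ φ, Extends φ g := by
  let ext (g : GA 3 K) :
      MvPolynomial (Fin 2) (RatFn K) →ₐ[RatFn K] MvPolynomial (Fin 2) (RatFn K) :=
    aeval fun i => toRatFn K (g (X i.castSucc))
  have ext_toRatFn {g : GA 3 K} (hg : g (X 2) = X 2) (f) :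
      ext g (toRatFn K f) = toRatFn K (g f) := by
    have : ((ext g).restrictScalars K).comp (toRatFn K) = (toRatFn K).comp g.toAlgHom := by
      refine algHom_ext fun j => ?_
      match j with
      | 0 => simp [ext]
      | 1 => simp [ext]
      | 2 => simp [ext, hg, MvPolynomial.algebraMap_eq]
    exact DFunLike.congr_fun this f
  have ext_comp {g h : GA 3 K} (hg : g (X 2) = X 2) (hgh : g * h = 1) :
      (ext g).comp (ext h) = AlgHom.id _ _ := algHom_ext fun i => by
    rw [AlgHom.comp_apply, aeval_X, ext_toRatFn hg, ← AlgEquiv.mul_apply, hgh, AlgEquiv.one_apply,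
      toRatFn_X_castSucc, AlgHom.id_apply]
  have hg' : g⁻¹ (X 2) = X 2 := g.symm_apply_eq.2 hg.symm
  exact ⟨AlgEquiv.ofAlgHom (ext g) (ext g⁻¹) (ext_comp hg (mul_inv_cancel g))
    (ext_comp hg' (inv_mul_cancel g)), ext_toRatFn hg⟩

namespace Extends

variable {φ ψ : GA 2 (RatFn K)} {g h : GA 3 K}

lemma mul (hφ : Extends φ g) (hψ : Extends ψ h) : Extends (φ * ψ) (g * h) := fun f => by
  rw [AlgEquiv.mul_apply, AlgEquiv.mul_apply, hψ, hφ]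

lemma inv (hφ : Extends φ g) : Extends φ⁻¹ g⁻¹ := fun f =>
  φ.symm_apply_eq.2 (by rw [hφ, ← AlgEquiv.mul_apply, mul_inv_cancel, AlgEquiv.one_apply])

lemma apply_X_zero (hφ : Extends φ g) : φ (X 0) = toRatFn K (g (X 0)) := by
  rw [← hφ, toRatFn_X_zero]

lemma apply_X_one (hφ : Extends φ g) : φ (X 1) = toRatFn K (g (X 1)) := by
  rw [← hφ, toRatFn_X_one]

lemma apply_X_two_eq (hφ : Extends φ g) : g (X 2) = X 2 :=
  toRatFn_injective (by rw [← hφ, toRatFn_X_two, GA.apply_C])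

end Extends

/-- The automorphisms of `K(z)[x,y]` that extend an element of `H`. -/
def genericFibre (H : Subgroup (GA 3 K)) : Subgroup (GA 2 (RatFn K)) where
  carrier := {φ | ∃ g ∈ H, Extends φ g}
  mul_mem' := fun ⟨g, hg, hφ⟩ ⟨h, hh, hψ⟩ => ⟨g * h, mul_mem hg hh, hφ.mul hψ⟩
  one_mem' := ⟨1, one_mem H, fun _ => rfl⟩
  inv_mem' := fun ⟨g, hg, hφ⟩ => ⟨g⁻¹, inv_mem hg, hφ.inv⟩

end GenericFibre

section AffineShears

variable {K : Type*} [Field K]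

lemma mem_fieldRange_of_mem_span {w : RatFn K} (hw : w ∈ Submodule.span K {1, zFn K})
    (hzw : zFn K * w ∈ Submodule.span K {1, zFn K}) : w ∈ (algebraMap K (RatFn K)).fieldRange := by
  obtain ⟨a, b, rfl⟩ := Submodule.mem_span_pair.1 hw
  obtain ⟨c, d, hcd⟩ := Submodule.mem_span_pair.1 hzw
  have hpoly : Polynomial.C c + Polynomial.C d * Polynomial.X =
      Polynomial.X * (Polynomial.C a + Polynomial.C b * Polynomial.X) := by
    apply IsFractionRing.injective (Polynomial K) (RatFn K)
    simpa [zFn, Algebra.smul_def, IsScalarTower.algebraMap_apply K (Polynomial K) (RatFn K)]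
      using hcd
  have hb : b = 0 := by
    simpa [Polynomial.coeff_C, Polynomial.coeff_X] using
      (congrArg (Polynomial.coeff · 2) hpoly).symm
  exact ⟨a, by simp [hb, Algebra.smul_def]⟩

lemma eq_zero_of_mem_fieldRange {w : RatFn K} (hw : w ∈ (algebraMap K (RatFn K)).fieldRange)
    (hzw : zFn K * w ∈ (algebraMap K (RatFn K)).fieldRange) : w = 0 := by
  obtain ⟨a, rfl⟩ := hw
  obtain ⟨b, hb⟩ := hzw
  have hpoly : Polynomial.C b = Polynomial.C a * Polynomial.X := by
    rw [mul_comm] at hb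
    apply IsFractionRing.injective (Polynomial K) (RatFn K)
    simpa [zFn, IsScalarTower.algebraMap_apply K (Polynomial K) (RatFn K)] using hb
  have ha : a = 0 := by simpa using (congrArg (Polynomial.coeff · 1) hpoly).symm
  rw [ha, map_zero]

lemma coeff_mem_of_toRatFn_eq_aeval {f : MvPolynomial (Fin 3) K} (hf : f.totalDegree ≤ 1)
    {R : Polynomial (RatFn K)} (h : toRatFn K f = Polynomial.aeval (X 1) R) :
    R.coeff 0 ∈ Submodule.span K {1, zFn K} ∧
      ∀ n, R.coeff (n + 1) ∈ (algebraMap K (RatFn K)).fieldRange := by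
  have hsupp : f ∈ supported K {1, 2} := by
    refine mem_supported_of_toRatFn_mem_supported (by simp) ?_
    rw [h]
    exact aeval_X_mem_supported (by simp) R
  have hspan : f ∈ Submodule.span K {1, X 1, X 2} :=
    mem_of_totalDegree_le_one (Submodule.subset_span (by simp))
      (fun i hi => Submodule.subset_span (by rcases hi with rfl | rfl <;> simp)) hsupp hf
  obtain ⟨a, b, c, rfl⟩ := Submodule.mem_span_triple.1 hspan
  have heval := congrArg (aeval fun _ : Fin 2 => (Polynomial.X : Polynomial (RatFn K))) h
  rw [← Polynomial.aeval_algHom_apply, aeval_X, Polynomial.aeval_X_left_apply] at heval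
  have hR : R = Polynomial.C (a • 1 + c • zFn K) +
      Polynomial.C (algebraMap K (RatFn K) b) * Polynomial.X := by
    rw [← heval]
    simp only [Algebra.smul_def, MvPolynomial.algebraMap_eq, mul_one, map_add, algHom_C,
      MvPolynomial.algebraMap_apply, map_mul, toRatFn_X_one, toRatFn_X_two,
      Polynomial.algebraMap_eq, aeval_X]
    ring
  refine ⟨?_, fun n => ?_⟩
  · rw [hR]
    exact Submodule.mem_span_pair.2 ⟨a, c, by simp⟩
  · rw [hR, Polynomial.coeff_add, Polynomial.coeff_C_succ, zero_add, Polynomial.coeff_C_mul,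
      Polynomial.coeff_X]
    split_ifs <;> simp

lemma IsShearAlong.mem_span_and_coeff_mem {H : Subgroup (GA 3 K)}
    (hH : ↑H ∩ BA 3 K ⊆ Aff 3 K) {φ : GA 2 (RatFn K)} (hφH : φ ∈ genericFibre H)
    {m : RatFn K} {R : Polynomial (RatFn K)} (hφ : IsShearAlong (X 1) (X 0) m R φ) :
    m ∈ Submodule.span K {1, zFn K} ∧ R.coeff 0 ∈ Submodule.span K {1, zFn K} ∧
      ∀ n, R.coeff (n + 1) ∈ (algebraMap K (RatFn K)).fieldRange := by
  obtain ⟨g, hgH, hg⟩ := hφH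
  have hg0 : toRatFn K (g (X 0) - X 0) = Polynomial.aeval (X 1) R := by
    rw [map_sub, ← hg.apply_X_zero, hφ.apply_fibre, toRatFn_X_zero, add_sub_cancel_left]
  have hg1 : toRatFn K (g (X 1) - X 1) = Polynomial.aeval (X 1) (Polynomial.C m) := by
    rw [map_sub, ← hg.apply_X_one, hφ.apply_base, toRatFn_X_one, add_sub_cancel_left,
      Polynomial.aeval_C]
  have hB : g ∈ BA 3 K := fun i => by
    refine ⟨1, g (X i) - X i, ?_, by simp⟩
    refine match i with
    | 0 => mem_supported_of_toRatFn_mem_supported (by simp) ?_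
    | 1 => mem_supported_of_toRatFn_mem_supported (by simp) ?_
    | 2 => ?_
    · rw [hg0]
      exact aeval_X_mem_supported (by simp) R
    · rw [hg1, Polynomial.aeval_C]
      exact C_mem_supported _ m
    · rw [hg.apply_X_two_eq, sub_self]
      exact zero_mem _
  have hdeg (i) : (g (X i) - X i).totalDegree ≤ 1 :=
    (totalDegree_sub _ _).trans (max_le (hH ⟨hgH, hB⟩ i).le (totalDegree_X i).le)
  have hm := (coeff_mem_of_toRatFn_eq_aeval (hdeg 1) hg1).1
  rw [Polynomial.coeff_C_zero] at hm
  exact ⟨hm, coeff_mem_of_toRatFn_eq_aeval (hdeg 0) hg0⟩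

lemma coeff_C_mul_sub_taylor_mul {L : Type*} [CommRing L] (a l m : L) {Q : Polynomial L} {n : ℕ}
    (hQ : Q.natDegree ≤ n + 1) :
    (Polynomial.C a * (Q - Polynomial.taylor (l * m) Q)).coeff n =
      l * (Polynomial.C a * (Q - Polynomial.taylor m Q)).coeff n := by
  simp only [Polynomial.coeff_C_mul, coeff_sub_taylor _ hQ]
  ring

lemma natDegree_le_one_of_coeff_mem_fieldRange [CharZero K] {a m : RatFn K} (ha : a ≠ 0)
    (hm : m ≠ 0) {Q : Polynomial (RatFn K)}
    (h : ∀ n, (Polynomial.C a * (Q - Polynomial.taylor m Q)).coeff (n + 1) ∈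
      (algebraMap K (RatFn K)).fieldRange)
    (hz : ∀ n, (Polynomial.C a * (Q - Polynomial.taylor (zFn K * m) Q)).coeff (n + 1) ∈
      (algebraMap K (RatFn K)).fieldRange) : Q.natDegree ≤ 1 := by
  by_contra! hdeg
  obtain ⟨n, hn⟩ : ∃ n, Q.natDegree = n + 1 + 1 := ⟨Q.natDegree - 2, by omega⟩
  have htop : (Polynomial.C a * (Q - Polynomial.taylor m Q)).coeff (n + 1) = 0 :=
    eq_zero_of_mem_fieldRange (h n) (coeff_C_mul_sub_taylor_mul a (zFn K) m hn.le ▸ hz n)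
  rw [Polynomial.coeff_C_mul, mul_eq_zero_iff_left ha, ← natDegree_sub_taylor hm hn,
    Polynomial.coeff_natDegree, Polynomial.leadingCoeff_eq_zero] at htop
  simpa [htop] using natDegree_sub_taylor hm hn

lemma exists_eq_linear_of_forall_exists_mem_genericFibre [CharZero K] {H : Subgroup (GA 3 K)}
    (hH : ↑H ∩ BA 3 K ⊆ Aff 3 K) {p m : RatFn K} (hp : p ≠ 0) (hm : m ≠ 0)
    {Q : Polynomial (RatFn K)}
    (h : ∀ l ∈ ({1, zFn K} : Set (RatFn K)), ∃ φ ∈ genericFibre H, φ (X 1) = X 1 + C (l * m) ∧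
      φ (C p * X 0 + Polynomial.aeval (X 1) Q) = C p * X 0 + Polynomial.aeval (X 1) Q) :
    ∃ w : K, ∃ q, Q = Polynomial.C (p * algebraMap K (RatFn K) w) * Polynomial.X +
      Polynomial.C q := by
  obtain ⟨φ, hφH, hφ, hfix⟩ := h 1 (by simp)
  rw [one_mul] at hφ
  obtain ⟨hm1, hbot, hcoeff⟩ :=
    (IsShearAlong.of_apply_eq_self hp hφ hfix).mem_span_and_coeff_mem hH hφH
  obtain ⟨ψ, hψH, hψ, hfix'⟩ := h (zFn K) (by simp)
  obtain ⟨hmz, hbot', hcoeff'⟩ :=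
    (IsShearAlong.of_apply_eq_self hp hψ hfix').mem_span_and_coeff_mem hH hψH
  have hQ : Q.natDegree ≤ 1 :=
    natDegree_le_one_of_coeff_mem_fieldRange (inv_ne_zero hp) hm hcoeff hcoeff'
  rw [coeff_C_mul_sub_taylor_mul _ _ _ hQ] at hbot'
  obtain ⟨w, hw⟩ := div_mem (mem_fieldRange_of_mem_span hbot hbot')
    (mem_fieldRange_of_mem_span hm1 hmz)
  refine ⟨-w, Q.coeff 0, ?_⟩
  have hlin : p * algebraMap K (RatFn K) (-w) = Q.coeff 1 := by
    rw [map_neg, hw, Polynomial.coeff_C_mul, coeff_sub_taylor m hQ]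
    field_simp
    simp
  rw [hlin]
  exact Polynomial.eq_X_add_C_of_natDegree_le_one hQ

end AffineShears

section RationalLength

variable {K : Type*} [Field K] {H : Subgroup (GA 3 K)} {σ : GA 3 K}

lemma exists_eq_of_toRatFn_eq {f : MvPolynomial (Fin 3) K} {p r : RatFn K}
    (h : toRatFn K f = C p * X 1 + C r) :
    ∃ q s : Polynomial K, f = Polynomial.aeval (X 2) q * X 1 + Polynomial.aeval (X 2) s := by
  have hcoeff (n) : algebraMap _ (RatFn K) ((overZ K f).coeff n) = coeff n (C p * X 1 + C r) := by
    rw [← h, toRatFn_apply, coeff_map]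
  refine ⟨(overZ K f).coeff (Finsupp.single 1 1), (overZ K f).coeff 0, toRatFn_injective ?_⟩
  rw [map_add, map_mul, toRatFn_aeval_X_two, toRatFn_aeval_X_two, toRatFn_X_one, hcoeff, hcoeff, h]
  simp [coeff_C, eq_comm (a := (0 : Fin 2 →₀ ℕ))]

lemma apply_aeval_X_two (hz : σ (X 2) = X 2) (q : Polynomial K) :
    σ (Polynomial.aeval (X 2) q) = Polynomial.aeval (X 2) q := by
  rw [← Polynomial.aeval_algHom_apply, hz]

lemma exists_apply_X_one_eq (hz : σ (X 2) = X 2) {p r : RatFn K}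
    (h : toRatFn K (σ (X 1)) = C p * X 1 + C r) :
    ∃ u : Kˣ, ∃ s : Polynomial K, σ (X 1) = C (u : K) * X 1 + Polynomial.aeval (X 2) s := by
  obtain ⟨q, s, hqs⟩ := exists_eq_of_toRatFn_eq h
  have hinv : X 1 = Polynomial.aeval (X 2) q * σ.symm (X 1) + Polynomial.aeval (X 2) s :=
    σ.injective (by rw [hqs]; simp [apply_aeval_X_two hz])
  -- Setting `y = s(z) + 1` in `y - s(z) = q(z) σ⁻¹(y)` shows that `q(z)` is a unit.
  have hunit : IsUnit (Polynomial.aeval (X 2 : MvPolynomial (Fin 3) K) q) := by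
    let π : MvPolynomial (Fin 3) K →ₐ[K] MvPolynomial (Fin 3) K :=
      aeval ![X 0, 1 + Polynomial.aeval (X 2) s, X 2]
    have hπ (f : Polynomial K) : π (Polynomial.aeval (X 2) f) = Polynomial.aeval (X 2) f := by
      rw [← Polynomial.aeval_algHom_apply, aeval_X]
      rfl
    have heval := congrArg π hinv
    rw [map_add, map_mul, hπ, hπ, aeval_X] at heval
    exact IsUnit.of_mul_eq_one _ (add_right_cancel heval).symm
  obtain ⟨c, ⟨u, rfl⟩, hu⟩ := isUnit_iff_eq_C_of_isReduced.1 hunit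
  exact ⟨u, s, by rw [hqs, hu]⟩

lemma mem_BA_of_toRatFn_apply_X_one_eq (hz : σ (X 2) = X 2) {p r : RatFn K}
    (h : toRatFn K (σ (X 1)) = C p * X 1 + C r) : σ ∈ BA 3 K := by
  obtain ⟨c, s, hσ⟩ := exists_apply_X_one_eq hz h
  have hs (t : Set (Fin 3)) (ht : 2 ∈ t) : Polynomial.aeval (X 2) s ∈ supported K t :=
    aeval_X_mem_supported ht s
  let e := elementary 1 c (Polynomial.aeval (X 2) s) (hs {1}ᶜ (by simp))
  have he1 : e (X 1) = C (c : K) * X 1 + Polynomial.aeval (X 2) s := elementary_X_self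
  have he2 : e (X 2) = X 2 := elementary_X_of_ne (by decide)
  obtain ⟨u, f, hf, hu⟩ := exists_apply_X_zero_eq_of_apply_X_succ_eq (φ := σ) (θ := e) fun j =>
    match j with
    | 0 => hσ.trans he1.symm
    | 1 => hz.trans he2.symm
  rw [show e (X 0) = X 0 from elementary_X_of_ne (by decide)] at hu
  have hef : e f ∈ supported K {j | (0 : Fin 3) < j} := by
    refine GA.mapsTo_supported (fun j hj => ?_) hf
    match j, hj with
    | 1, _ =>
      rw [he1]
      exact add_mem (mul_mem (C_mem_supported _ _) (X_mem_supported.2 (by simp))) (hs _ (by simp))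
    | 2, _ =>
      rw [he2]
      exact X_mem_supported.2 (by simp)
  intro i
  match i with
  | 0 => exact ⟨u, e f, hef, hu⟩
  | 1 => exact ⟨c, _, hs _ (by simp), hσ⟩
  | 2 => exact ⟨1, 0, zero_mem _, by simp [hz]⟩

lemma exists_mem_genericFibre_apply_X_zero_eq_add (hA : Aff 3 K ⊆ H) {l : RatFn K}
    (hl : l ∈ ({1, zFn K} : Set (RatFn K))) :
    ∃ ψ ∈ genericFibre H, ψ (X 0) = X 0 + C l ∧ ψ (X 1) = X 1 := by
  obtain ⟨f, hf, hdeg, hfl⟩ : ∃ f ∈ supported K {(0 : Fin 3)}ᶜ, f.totalDegree ≤ 1 ∧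
      toRatFn K f = C l := by
    rcases hl with rfl | rfl
    · exact ⟨1, one_mem _, by simp, by simp⟩
    · exact ⟨X 2, X_mem_supported.2 (by simp), (totalDegree_X _).le, toRatFn_X_two⟩
  obtain ⟨ψ, hψ⟩ := exists_extends (g := elementary 0 1 f hf) (elementary_X_of_ne (by decide))
  refine ⟨ψ, ⟨_, hA (elementary_mem_Aff hdeg), hψ⟩, ?_, ?_⟩
  · rw [hψ.apply_X_zero, elementary_X_self]
    simp [hfl]
  · rw [hψ.apply_X_one, elementary_X_of_ne (by decide), toRatFn_X_one]

lemma exists_mem_genericFibre_apply_eq_add (hA : Aff 3 K ⊆ H) (hσ : σ ∈ H) (hz : σ (X 2) = X 2)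
    {θ : GA 2 (RatFn K)} (hθ : θ (X 1) = toRatFn K (σ (X 1))) :
    ∃ s ≠ 0, ∀ l ∈ ({1, zFn K} : Set (RatFn K)), ∃ φ ∈ genericFibre H,
      φ (θ (X 0)) = θ (X 0) + C (l * s) ∧ φ (θ (X 1)) = θ (X 1) := by
  obtain ⟨Φ, hΦ⟩ := exists_extends hz
  have h1 : θ (X 1) = Φ (X 1) := hθ.trans hΦ.apply_X_one.symm
  obtain ⟨u, f, hf, h0⟩ := exists_apply_X_zero_eq_of_apply_X_succ_eq (φ := θ) (θ := Φ)
    fun j => match j with | 0 => h1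
  refine ⟨u, u.ne_zero, fun l hl => ?_⟩
  obtain ⟨ψ, hψH, hψ0, hψ1⟩ := exists_mem_genericFibre_apply_X_zero_eq_add hA hl
  have hψf : ψ f = f := GA.apply_eq_self_of_mem_supported (fun j hj => by
    match j, hj with
    | 1, _ => exact hψ1) hf
  have hconj (p) : (Φ * ψ * Φ⁻¹) (Φ p) = Φ (ψ p) := by
    rw [← AlgEquiv.mul_apply, inv_mul_cancel_right, AlgEquiv.mul_apply]
  have hΦH : Φ ∈ genericFibre H := ⟨σ, hσ, hΦ⟩
  refine ⟨Φ * ψ * Φ⁻¹, mul_mem (mul_mem hΦH hψH) (inv_mem hΦH), ?_, ?_⟩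
  · rw [h0, map_add, map_mul, GA.apply_C, hconj, hconj, hψ0, hψf, map_add, GA.apply_C, C_mul]
    ring
  · rw [h1, hconj, hψ1]

lemma exists_mem_Aff_extends (w : K) : ∃ κ ∈ Aff 3 K, ∃ φ : GA 2 (RatFn K), Extends φ κ ∧
    φ (X 1) = X 0 ∧ ∀ p q, φ (C p * X 0 + Polynomial.aeval (X 1)
      (Polynomial.C (p * algebraMap K (RatFn K) w) * Polynomial.X + Polynomial.C q)) =
        C p * X 1 + C q := by
  let e : GA 3 K := elementary 0 1 (-(C w * X 1))
    (neg_mem (mul_mem (C_mem_supported _ _) (X_mem_supported.2 (by simp))))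
  let s : GA 3 K := renameEquiv K (Equiv.swap 0 1)
  have h0 : (s * e) (X 0) = X 1 - C w * X 0 := by
    simp [s, e, sub_eq_add_neg]
  have h1 : (s * e) (X 1) = X 0 := by
    simp [s, e, elementary_X_of_ne]
  have h2 : (s * e) (X 2) = X 2 := by
    simp [s, e, elementary_X_of_ne, Equiv.swap_apply_of_ne_of_ne]
  have hκ : s * e ∈ affineSubgroup 3 K :=
    mul_mem (show s ∈ affineSubgroup 3 K from renameEquiv_mem_Aff _)
      (show e ∈ affineSubgroup 3 K from elementary_mem_Aff (by
        rw [totalDegree_neg, ← smul_eq_C_mul]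
        exact (totalDegree_smul_le _ _).trans (totalDegree_X _).le))
  obtain ⟨φ, hφ⟩ := exists_extends h2
  refine ⟨s * e, hκ, φ, hφ, by rw [hφ.apply_X_one, h1, toRatFn_X_zero],
    fun p q => ?_⟩
  rw [map_add, map_mul, GA.apply_C, ← Polynomial.aeval_algHom_apply, hφ.apply_X_zero,
    hφ.apply_X_one, h0, h1]
  simp only [map_sub, toRatFn_X_one, map_mul, algHom_C, MvPolynomial.algebraMap_apply,
    toRatFn_X_zero, map_add, Polynomial.aeval_C, MvPolynomial.algebraMap_eq, Polynomial.aeval_X]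
  ring

lemma mem_Aff_of_toRatFn_apply_X_one_eq_add_aeval [CharZero K] (hA : Aff 3 K ⊆ H)
    (hH : ↑H ∩ BA 3 K ⊆ Aff 3 K) (hσ : σ ∈ H) (hz : σ (X 2) = X 2) {p : RatFn K} (hp : p ≠ 0)
    {Q : Polynomial (RatFn K)}
    (hy : toRatFn K (σ (X 1)) = C p * X 0 + Polynomial.aeval (X 1) Q) : σ ∈ Aff 3 K := by
  let e : GA 2 (RatFn K) := elementary 0 (Units.mk0 p hp) (Polynomial.aeval (X 1) Q)
    (aeval_X_mem_supported (by simp) Q)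
  have he0 : e (X 0) = C p * X 0 + Polynomial.aeval (X 1) Q := elementary_X_self
  have he1 : e (X 1) = X 1 := elementary_X_of_ne (by decide)
  let θ : GA 2 (RatFn K) := e * renameEquiv _ (Equiv.swap 0 1)
  have hθ0 : θ (X 0) = X 1 := by simp [θ, he1]
  have hθ1 : θ (X 1) = C p * X 0 + Polynomial.aeval (X 1) Q := by simp [θ, he0]
  obtain ⟨s, hs, hφ⟩ := exists_mem_genericFibre_apply_eq_add hA hσ hz (hθ1.trans hy.symm)
  rw [hθ0, hθ1] at hφ
  obtain ⟨w, q, rfl⟩ := exists_eq_linear_of_forall_exists_mem_genericFibre hH hp hs hφ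
  obtain ⟨κ, hκ, φ, hφκ, -, hφ1⟩ := exists_mem_Aff_extends w
  have hκσ : toRatFn K ((κ * σ) (X 1)) = C p * X 1 + C q := by
    rw [AlgEquiv.mul_apply, ← hφκ, hy, hφ1]
  have hκσA : κ * σ ∈ affineSubgroup 3 K :=
    hH ⟨mul_mem (hA hκ) hσ, mem_BA_of_toRatFn_apply_X_one_eq
      (by rw [AlgEquiv.mul_apply, hz, hφκ.apply_X_two_eq]) hκσ⟩
  exact ((affineSubgroup 3 K).mul_mem_cancel_left hκ).1 hκσA

lemma exists_inner_eq_linear [CharZero K] (hA : Aff 3 K ⊆ H) (hH : ↑H ∩ BA 3 K ⊆ Aff 3 K)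
    (hσ : σ ∈ H) (hz : σ (X 2) = X 2) {p₁ p₂ : RatFn K} (hp₁ : p₁ ≠ 0) (hp₂ : p₂ ≠ 0)
    {Q₁ Q₂ : Polynomial (RatFn K)} (hQ₂ : 2 ≤ Q₂.natDegree)
    (hy : toRatFn K (σ (X 1)) =
      C p₂ * X 1 + Polynomial.aeval (C p₁ * X 0 + Polynomial.aeval (X 1) Q₁) Q₂) :
    ∃ w : K, ∃ q, Q₁ = Polynomial.C (p₁ * algebraMap K (RatFn K) w) * Polynomial.X +
      Polynomial.C q := by
  set P : MvPolynomial (Fin 2) (RatFn K) := C p₁ * X 0 + Polynomial.aeval (X 1) Q₁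
  let e₁ : GA 2 (RatFn K) := elementary 0 (Units.mk0 p₁ hp₁) (Polynomial.aeval (X 1) Q₁)
    (aeval_X_mem_supported (by simp) Q₁)
  let e₂ : GA 2 (RatFn K) := elementary 1 (Units.mk0 p₂ hp₂) (Polynomial.aeval (X 0) Q₂)
    (aeval_X_mem_supported (by simp) Q₂)
  have he₁ : e₁ (X 0) = P := elementary_X_self
  have hθ0 : (e₁ * e₂) (X 0) = P := by
    rw [AlgEquiv.mul_apply, elementary_X_of_ne (by decide), he₁]
  have hθ1 : (e₁ * e₂) (X 1) = C p₂ * X 1 + Polynomial.aeval P Q₂ := by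
    rw [AlgEquiv.mul_apply, elementary_X_self, map_add, map_mul, GA.apply_C,
      ← Polynomial.aeval_algHom_apply, he₁, elementary_X_of_ne (by decide), Units.val_mk0]
  obtain ⟨s, hs, hφ⟩ := exists_mem_genericFibre_apply_eq_add hA hσ hz (hθ1.trans hy.symm)
  rw [hθ0, hθ1] at hφ
  obtain ⟨τ, hτH, hτ0, hτ1⟩ :=
    exists_mem_genericFibre_apply_X_zero_eq_add hA (Set.mem_insert 1 {zFn K})
  have hτ : IsShearAlong P (X 1) p₁ 0 τ := by
    refine ⟨?_, by simp [hτ1]⟩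
    rw [map_add, map_mul, GA.apply_C, hτ0, ← Polynomial.aeval_algHom_apply, hτ1,
      MvPolynomial.algebraMap_eq, C_1]
    ring
  obtain ⟨r, hr, hχ⟩ := IsShearAlong.exists_translation hτH hτ hp₁ hp₂ hQ₂
  refine exists_eq_linear_of_forall_exists_mem_genericFibre hH hp₁ (mul_ne_zero hs hr)
    fun l hl => ?_
  obtain ⟨φ, hφH, hφP, hφy⟩ := hφ l hl
  obtain ⟨χ, hχH, hχP, hχy⟩ := hχ (l * s) φ hφH hφP hφy
  exact ⟨χ, hχH, by rw [hχy, mul_assoc, MvPolynomial.algebraMap_eq], hχP⟩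

lemma mem_Aff_of_toRatFn_apply_X_one_eq_add_aeval_add_aeval [CharZero K] (hA : Aff 3 K ⊆ H)
    (hH : ↑H ∩ BA 3 K ⊆ Aff 3 K) (hσ : σ ∈ H) (hz : σ (X 2) = X 2) {p₁ p₂ : RatFn K}
    (hp₁ : p₁ ≠ 0) (hp₂ : p₂ ≠ 0) {Q₁ Q₂ : Polynomial (RatFn K)}
    (hy : toRatFn K (σ (X 1)) =
      C p₂ * X 1 + Polynomial.aeval (C p₁ * X 0 + Polynomial.aeval (X 1) Q₁) Q₂) :
    σ ∈ Aff 3 K := by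
  obtain hQ₂ | hQ₂ := le_or_gt Q₂.natDegree 1
  · obtain ⟨b, c, rfl⟩ := Polynomial.exists_eq_X_add_C_of_natDegree_le_one hQ₂
    obtain rfl | hb := eq_or_ne b 0
    · refine hH ⟨hσ, mem_BA_of_toRatFn_apply_X_one_eq hz (p := p₂) (r := c) ?_⟩
      simp [hy, MvPolynomial.algebraMap_eq]
    · refine mem_Aff_of_toRatFn_apply_X_one_eq_add_aeval hA hH hσ hz (mul_ne_zero hb hp₁)
        (Q := Polynomial.C p₂ * Polynomial.X + Polynomial.C b * Q₁ + Polynomial.C c) ?_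
      simp only [hy, map_add, map_mul, Polynomial.aeval_C, MvPolynomial.algebraMap_eq,
        Polynomial.aeval_X]
      ring
  · obtain ⟨w, q, rfl⟩ := exists_inner_eq_linear hA hH hσ hz hp₁ hp₂ hQ₂ hy
    obtain ⟨κ, hκ, φ, hφκ, hφ1, hφP⟩ := exists_mem_Aff_extends w
    have hκσ : toRatFn K ((κ * σ) (X 1)) = C p₂ * X 0 +
        Polynomial.aeval (X 1) (Q₂.comp (Polynomial.C p₁ * Polynomial.X + Polynomial.C q)) := by
      rw [AlgEquiv.mul_apply, ← hφκ, hy, map_add, map_mul, GA.apply_C, hφ1,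
        ← Polynomial.aeval_algHom_apply, hφP, Polynomial.aeval_comp]
      simp [MvPolynomial.algebraMap_eq]
    have hκσA : κ * σ ∈ affineSubgroup 3 K :=
      mem_Aff_of_toRatFn_apply_X_one_eq_add_aeval hA hH (mul_mem (hA hκ) hσ)
        (by rw [AlgEquiv.mul_apply, hz, hφκ.apply_X_two_eq]) hp₂ hκσ
    exact ((affineSubgroup 3 K).mul_mem_cancel_left hκ).1 hκσA

end RationalLength

end CoTame

end

theorem mainTheorem4 (K : Type*) [Field K] [CharZero K] (σ : CoTame.GA 3 K)
    (hσ : σ ∉ CoTame.Aff 3 K)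
    (hz : σ (MvPolynomial.X 2) = MvPolynomial.X 2)
    (hy : CoTame.overZ K (σ (MvPolynomial.X 1)) ∈ CoTame.rationalClass (Polynomial K) 2) :
    CoTame.IsCoTame σ := by
  have hA : CoTame.Aff 3 K ⊆ Subgroup.closure (CoTame.Aff 3 K ∪ {σ}) :=
    Set.subset_union_left.trans Subgroup.subset_closure
  refine (Subgroup.closure_le _).2 (Set.union_subset hA ?_)
  by_contra hBA
  have hH : ↑(Subgroup.closure (CoTame.Aff 3 K ∪ {σ})) ∩ CoTame.BA 3 K ⊆ CoTame.Aff 3 K := by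
    rintro β ⟨hβ, hβB⟩
    by_contra hβA
    exact hBA (CoTame.BA_subset_of_mem hA le_rfl hβ hβB hβA)
  obtain ⟨p, Q, hp, hF⟩ := hy
  exact hσ (CoTame.mem_Aff_of_toRatFn_apply_X_one_eq_add_aeval_add_aeval hA hH
    (Subgroup.subset_closure (Or.inr rfl)) hz (nonZeroDivisors.ne_zero (hp 1))
    (nonZeroDivisors.ne_zero (hp 2)) hF)
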